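/- **Theorem 4.3.** Let $\mathcal T=(V,E,F)$ be an infinite disk triangulation, that is, a locally finite simplicial triangulation, with infinitely many vertices, of a simply connected surface without boundary that has exactly one end, and let $\Phi\in[0,\frac{\pi}{2}]^E$. For $u\in(-\infty,0)^V$ let $r_i>0$ be determined by $u_i=\ln\tanh\frac{r_i}{2}$, and give each edge $\{i,j\}\in E$ the length $$l_{ij}=\cosh^{-1}\bigl(\cosh r_i\cosh r_j+\cos\Phi_{ij}\,\sinh r_i\sinh r_j\bigr).$$ Then $u$ is called the discrete conformal factor of the hyperbolic circle-packing metric $r$, and its discrete Gaussian curvature at $i\in V$ is $$K_i(u)=2\pi-\sum_{\{i,j,k\}\in F}\theta_i^{jk},$$ where $\theta_i^{jk}$ is the inner angle at $i$ of the hyperbolic triangle with side lengths $l_{ij},l_{jk},l_{ik}$. If $u_0\in(-\infty,0)^V$ and $\hat K\in\mathbb R^V$ satisfy $K_i(u_0)\le\hat K_i<2\pi$ for all $i\in V$, then there exists $u^*\in(-\infty,0)^V$ such that $K_i(u^*)=\hat K_i$ for all $i\in V$. -/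

import Mathlib

noncomputable section

namespace CirclePacking

variable {V : Type*}

/-- `{i, j, k}` is a two-dimensional face of `T` (so `i`, `j`, `k` are distinct). -/
def IsTriangle (T : AbstractSimplicialComplex V) (i j k : V) : Prop :=
  ∃ f ∈ T.faces, f.card = 3 ∧ (f : Set V) = {i, j, k}

/-- The 1-skeleton of `T`: vertices `i ≠ j` are adjacent iff `{i, j}` is an edge of `T`. -/
def skeleton (T : AbstractSimplicialComplex V) : SimpleGraph V where
  Adj i j := i ≠ j ∧ ∃ f ∈ T.faces, (f : Set V) = {i, j}
  symm := by
    constructor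
    rintro i j ⟨hne, f, hf, h⟩
    exact ⟨hne.symm, f, hf, by rw [h, Set.pair_comm]⟩
  loopless := ⟨fun _ h => h.1 rfl⟩

/-- Every vertex lies in only finitely many simplices. -/
def LocallyFinite (T : AbstractSimplicialComplex V) : Prop :=
  ∀ i : V, {f : Finset V | f ∈ T.faces ∧ i ∈ f}.Finite

/-- The geometric realization of `T` in barycentric coordinates, as a subspace of `V → ℝ`
(product topology). For a locally finite complex this topology is the usual (weak) one. -/
def Realization (T : AbstractSimplicialComplex V) : Type _ :=
  {x : V → ℝ // (∀ v, 0 ≤ x v) ∧ ∃ f ∈ T.faces, (∀ v ∉ f, x v = 0) ∧ ∑ v ∈ f, x v = 1}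

instance (T : AbstractSimplicialComplex V) : TopologicalSpace (Realization T) :=
  inferInstanceAs (TopologicalSpace {x : V → ℝ // (∀ v, 0 ≤ x v) ∧
    ∃ f ∈ T.faces, (∀ v ∉ f, x v = 0) ∧ ∑ v ∈ f, x v = 1})

/-- An infinite disk triangulation: a locally finite triangulation, with infinitely many vertices,
of a simply connected surface (without boundary) that has exactly one end. The surface is the
geometric realization. It is Hausdorff by construction, and second countable because the complex
is connected and locally finite. The ends of the triangulation are those of its locally finite
1-skeleton. -/
structure IsInfiniteDiskTriangulation (T : AbstractSimplicialComplex V) : Prop where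
  infinite : Infinite V
  locallyFinite : LocallyFinite T
  surface : Nonempty (ChartedSpace (EuclideanSpace ℝ (Fin 2)) (Realization T))
  simplyConnected : SimplyConnectedSpace (Realization T)
  one_end : ∃! e, e ∈ (skeleton T).end

/-- Hyperbolic length of the edge `{i, j}` for the radii `r` and intersection angles `Φ`. -/
def edgeLength (Φ : Sym2 V → ℝ) (r : V → ℝ) (i j : V) : ℝ :=
  Real.arcosh (Real.cosh (r i) * Real.cosh (r j) +
    Real.cos (Φ s(i, j)) * Real.sinh (r i) * Real.sinh (r j))

lemma edgeLength_comm (Φ : Sym2 V → ℝ) (r : V → ℝ) (i j : V) :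
    edgeLength Φ r i j = edgeLength Φ r j i := by
  unfold edgeLength
  rw [Sym2.eq_swap]
  ring_nf

/-- The inner angle at the vertex with adjacent sides `b`, `c` and opposite side `a` of a
hyperbolic triangle (hyperbolic law of cosines). -/
def hyperbolicAngle (a b c : ℝ) : ℝ :=
  Real.arccos ((Real.cosh b * Real.cosh c - Real.cosh a) / (Real.sinh b * Real.sinh c))

/-- The inner angle at `i` of the triangle `{i, j, k}`, as a function of the pair `{j, k}`. -/
def innerAngle (Φ : Sym2 V → ℝ) (r : V → ℝ) (i : V) : Sym2 V → ℝ :=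
  Sym2.lift ⟨fun j k =>
    hyperbolicAngle (edgeLength Φ r j k) (edgeLength Φ r i j) (edgeLength Φ r i k), by
      intro j k
      simp only [hyperbolicAngle]
      rw [edgeLength_comm Φ r j k, mul_comm (Real.cosh (edgeLength Φ r i j)),
        mul_comm (Real.sinh (edgeLength Φ r i j))]⟩

/-- The pairs `{j, k}` such that `{i, j, k}` is a face; they correspond to the faces at `i`. -/
def oppositeEdges (T : AbstractSimplicialComplex V) (i : V) : Set (Sym2 V) :=
  {e | ∃ j k, e = s(j, k) ∧ IsTriangle T i j k}

/-- The radius `r` with discrete conformal factor `u = ln (tanh (r / 2)) < 0`. -/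
def radius (u : ℝ) : ℝ := 2 * Real.artanh (Real.exp u)

lemma radius_pos {u : ℝ} (hu : u < 0) : 0 < radius u :=
  mul_pos two_pos (Real.artanh_pos ⟨Real.exp_pos u, by simpa using hu⟩)

lemma log_tanh_radius {u : ℝ} (hu : u < 0) : Real.log (Real.tanh (radius u / 2)) = u := by
  have h : radius u / 2 = Real.artanh (Real.exp u) := by unfold radius; ring
  rw [h, Real.tanh_artanh ⟨by linarith [Real.exp_pos u], by simpa using hu⟩, Real.log_exp]

/-- The discrete Gaussian curvature at `i` of the hyperbolic circle-packing metric on `T` with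
intersection angles `Φ` and discrete conformal factors `u`: `2π` minus the sum of the inner angles
at `i` over all faces at `i`. -/
def curvature (T : AbstractSimplicialComplex V) (Φ : Sym2 V → ℝ) (u : V → ℝ) (i : V) : ℝ :=
  2 * Real.pi - ∑ᶠ e ∈ oppositeEdges T i, innerAngle Φ (fun v => radius (u v)) i e

lemma oppositeEdges_finite {T : AbstractSimplicialComplex V} (hT : LocallyFinite T) (i : V) :
    (oppositeEdges T i).Finite := by
  have hA : (⋃ f ∈ {f : Finset V | f ∈ T.faces ∧ i ∈ f}, (f : Set V)).Finite :=
    (hT i).biUnion fun f _ => f.finite_toSet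
  refine ((hA.prod hA).image fun p => s(p.1, p.2)).subset ?_
  rintro e ⟨j, k, rfl, f, hf, -, h⟩
  have hi : i ∈ (f : Set V) := by simp [h]
  have hj : j ∈ (f : Set V) := by simp [h]
  have hk : k ∈ (f : Set V) := by simp [h]
  exact ⟨(j, k), ⟨Set.mem_biUnion (show f ∈ _ from ⟨hf, hi⟩) hj,
    Set.mem_biUnion (show f ∈ _ from ⟨hf, hi⟩) hk⟩, rfl⟩

end CirclePacking

end

noncomputable section

namespace CirclePacking

open Real Set Filter Topology

variable {V : Type*}

/-! Perron's method: the pointwise supremum of all subsolutions `u < 0`, those with curvature at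
most the prescribed one, is a solution. Three facts make it work. Raising the radii of the
neighbours of a vertex opens its angles, so it lowers its curvature (`cosAngle_le_cosAngle`,
`curvature_le_curvature`). The curvature at a vertex is continuous in its own factor. As its radius
grows, its finitely many angles tend to `0` uniformly in the other radii, so a curvature bound below
`2π` keeps `u` away from `0` (`one_sub_le_cosAngle`, `exists_upper_bound_of_curvature_le`). The
given `u₀` makes the family of subsolutions nonempty. -/

/-! ### Trigonometry of one triangle in terms of its radii -/

/-- The hyperbolic cosine of the length of an edge with radii `x`, `y` at its ends and intersection
angle of cosine `a`. -/
def coshLength (a x y : ℝ) : ℝ := cosh x * cosh y + a * sinh x * sinh y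

/-- The cosine of the inner angle at the vertex of radius `x` in a triangle with radii `x`, `y`,
`z`, where `a`, `b`, `c` are the cosines of the intersection angles on the edges `xy`, `yz`,
`xz`. -/
def cosAngle (a b c x y z : ℝ) : ℝ :=
  (coshLength a x y * coshLength c x z - coshLength b y z) /
    (√(coshLength a x y ^ 2 - 1) * √(coshLength c x z ^ 2 - 1))

lemma cosh_mul_cosh_le_coshLength {a x y : ℝ} (ha : 0 ≤ a) (hx : 0 < x) (hy : 0 < y) :
    cosh x * cosh y ≤ coshLength a x y := by
  have := sinh_pos_iff.2 hx
  have := sinh_pos_iff.2 hy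
  have : 0 ≤ a * sinh x * sinh y := by positivity
  unfold coshLength
  linarith

lemma one_lt_coshLength {a x y : ℝ} (ha : 0 ≤ a) (hx : 0 < x) (hy : 0 < y) :
    1 < coshLength a x y :=
  (one_lt_mul_of_lt_of_le (one_lt_cosh.2 hx.ne') (one_le_cosh y)).trans_le
    (cosh_mul_cosh_le_coshLength ha hx hy)

/-- The root is the `sinh` of the edge length. The factor `cosh y` kept here cancels the one in
`coshLength_le`, which leaves a bound in `x` alone. -/
lemma sinh_mul_cosh_le_sqrt {a x y : ℝ} (ha : 0 ≤ a) (hx : 0 < x) (hy : 0 < y) :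
    sinh x * cosh y ≤ √(coshLength a x y ^ 2 - 1) := by
  have h := cosh_mul_cosh_le_coshLength ha hx hy
  have h1 := one_le_cosh y
  have h2 := one_le_cosh x
  have h3 : (cosh x * cosh y) ^ 2 ≤ coshLength a x y ^ 2 := by gcongr
  apply le_sqrt_of_sq_le
  have h4 : (cosh x * cosh y) ^ 2 = (sinh x * cosh y) ^ 2 + cosh y ^ 2 := by
    rw [mul_pow, cosh_sq x]
    ring
  nlinarith

lemma coshLength_le {b y z : ℝ} (hb : b ≤ 1) (hy : 0 < y) (hz : 0 < z) :
    coshLength b y z ≤ 2 * (cosh y * cosh z) := by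
  have h1 := sinh_pos_iff.2 hy
  have h2 := sinh_pos_iff.2 hz
  have h3 : sinh y * sinh z ≤ cosh y * cosh z :=
    mul_le_mul (sinh_lt_cosh y).le (sinh_lt_cosh z).le h2.le (cosh_pos y).le
  have h4 : b * (sinh y * sinh z) ≤ 1 * (sinh y * sinh z) := by gcongr
  unfold coshLength
  linarith

lemma cosAngle_comm (a b c x y z : ℝ) : cosAngle a b c x y z = cosAngle c b a x z y := by
  have h : coshLength b y z = coshLength b z y := by unfold coshLength; ring
  unfold cosAngle
  rw [h, mul_comm (coshLength a x y), mul_comm (√(coshLength a x y ^ 2 - 1))]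

/-- The inner angle at a vertex tends to `0` as its radius tends to infinity, uniformly in the
other radii. -/
lemma one_sub_le_cosAngle {a b c x y z : ℝ} (ha : 0 ≤ a) (hb : b ≤ 1) (hc : 0 ≤ c)
    (hx : 0 < x) (hy : 0 < y) (hz : 0 < z) :
    1 - 2 / sinh x ^ 2 ≤ cosAngle a b c x y z := by
  have hX := one_lt_coshLength ha hx hy
  have hY := one_lt_coshLength hc hx hz
  have hp := sinh_mul_cosh_le_sqrt ha hx hy
  have hq := sinh_mul_cosh_le_sqrt hc hx hz
  have hZ := coshLength_le hb hy hz
  have hS := sinh_pos_iff.2 hx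
  have hCy := cosh_pos y
  have hCz := cosh_pos z
  unfold cosAngle
  set X := coshLength a x y
  set Y := coshLength c x z
  set Z := coshLength b y z
  have hp' : √(X ^ 2 - 1) ≤ X := by
    rw [sqrt_le_left (by linarith)]
    linarith
  have hq' : √(Y ^ 2 - 1) ≤ Y := by
    rw [sqrt_le_left (by linarith)]
    linarith
  set p := √(X ^ 2 - 1)
  set q := √(Y ^ 2 - 1)
  have hp0 : 0 < p := lt_of_lt_of_le (by positivity) hp
  have hq0 : 0 < q := lt_of_lt_of_le (by positivity) hq
  have hpq : p * q ≤ X * Y := mul_le_mul hp' hq' hq0.le (by linarith)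
  have hlow : sinh x ^ 2 * (cosh y * cosh z) ≤ p * q :=
    calc _ = (sinh x * cosh y) * (sinh x * cosh z) := by ring
      _ ≤ p * q := mul_le_mul hp hq (by positivity) hp0.le
  rw [le_div_iff₀ (by positivity)]
  have : 2 * (cosh y * cosh z) ≤ 2 / sinh x ^ 2 * (p * q) := by
    rw [div_mul_eq_mul_div, le_div_iff₀ (by positivity)]
    linarith
  linarith

lemma hasDerivAt_coshLength (a x y : ℝ) :
    HasDerivAt (fun t => coshLength a x t) (cosh x * sinh y + a * sinh x * cosh y) y :=
  ((hasDerivAt_cosh y).const_mul _).add ((hasDerivAt_sinh y).const_mul _)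

lemma hasDerivAt_coshLength_left (b y z : ℝ) :
    HasDerivAt (fun t => coshLength b t z) (sinh y * cosh z + b * cosh y * sinh z) y :=
  ((hasDerivAt_cosh y).mul_const _).add (((hasDerivAt_sinh y).const_mul _).mul_const _)

/-- This is the derivative of `cosAngle` in `y` up to a positive factor. -/
lemma cosAngle_deriv_numerator_nonpos {a b c x y z : ℝ} (ha : a ∈ Icc 0 1) (hb : 0 ≤ b)
    (hc : 0 ≤ c) (hx : 0 < x) (hy : 0 < y) (hz : 0 < z) :
    (coshLength a x y * coshLength b y z - coshLength c x z) *
        (cosh x * sinh y + a * sinh x * cosh y) -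
      (coshLength a x y ^ 2 - 1) * (sinh y * cosh z + b * cosh y * sinh z) ≤ 0 := by
  have hSx := sinh_pos_iff.2 hx
  have hSy := sinh_pos_iff.2 hy
  have hSz := sinh_pos_iff.2 hz
  have hCx := cosh_pos x
  have hCy := cosh_pos y
  have hCz := cosh_pos z
  have h1 := cosh_sq x
  have h2 := cosh_sq y
  have ha0 := ha.1
  have ha1 : 0 ≤ 1 - a ^ 2 := by nlinarith [ha.1, ha.2]
  -- Every summand in the last bracket is nonnegative; `1 - a ^ 2` is where `a ≤ 1` enters.
  have key : (coshLength a x y * coshLength b y z - coshLength c x z) *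
        (cosh x * sinh y + a * sinh x * cosh y) -
      (coshLength a x y ^ 2 - 1) * (sinh y * cosh z + b * cosh y * sinh z) =
      -(sinh y * sinh x ^ 2 * cosh z * (1 - a ^ 2) + b * sinh x ^ 2 * sinh z * cosh y +
        a * b * sinh x * cosh x * sinh z * sinh y +
        c * sinh x * sinh z * (cosh x * sinh y + a * sinh x * cosh y)) := by
    unfold coshLength
    generalize cosh x = Cx at *
    generalize cosh y = Cy at *
    generalize cosh z = Cz at *
    generalize sinh x = Sx at *
    generalize sinh y = Sy at *
    generalize sinh z = Sz at *
    linear_combination ((Cx * Cy + a * Sx * Sy) * (a * Sx * Cz - b * Cx * Sz)) * h2 +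
      (-Sy * Cz - b * Cy * Sz) * h1
  rw [key, neg_nonpos]
  positivity

lemma cosAngle_antitoneOn {a b c x z : ℝ} (ha : a ∈ Icc 0 1) (hb : 0 ≤ b)
    (hc : 0 ≤ c) (hx : 0 < x) (hz : 0 < z) :
    AntitoneOn (fun y => cosAngle a b c x y z) (Ioi 0) := by
  have hder : ∀ y ∈ Ioi (0 : ℝ), ∃ d ≤ 0, HasDerivAt (fun y => cosAngle a b c x y z) d y := by
    intro y hy
    have hX := one_lt_coshLength ha.1 hx hy
    have hY := one_lt_coshLength hc hx hz
    have hp : 0 < √(coshLength a x y ^ 2 - 1) := sqrt_pos.2 (by nlinarith)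
    have hq : 0 < √(coshLength c x z ^ 2 - 1) := sqrt_pos.2 (by nlinarith)
    have hpp := sq_sqrt (show 0 ≤ coshLength a x y ^ 2 - 1 by nlinarith)
    have hN := cosAngle_deriv_numerator_nonpos ha hb hc hx hy hz
    have dX := hasDerivAt_coshLength a x y
    have dZ := hasDerivAt_coshLength_left b y z
    have dp : HasDerivAt (fun t => √(coshLength a x t ^ 2 - 1)) _ y :=
      ((dX.fun_pow 2).sub_const 1).sqrt (by nlinarith)
    have dF := ((dX.mul_const (coshLength c x z)).sub dZ).div
      (dp.mul_const (√(coshLength c x z ^ 2 - 1))) (by positivity)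
    refine ⟨_, ?_, dF⟩
    set X := coshLength a x y
    set Y := coshLength c x z
    set Z := coshLength b y z
    set X' := cosh x * sinh y + a * sinh x * cosh y
    set Z' := sinh y * cosh z + b * cosh y * sinh z
    set p := √(X ^ 2 - 1)
    set q := √(Y ^ 2 - 1)
    -- The numerator from the quotient rule, simplified with `p ^ 2 = X ^ 2 - 1`.
    have : ((X' * Y - Z') * (p * q) - (X * Y - Z) * ((2 : ℕ) * X ^ (2 - 1) * X' / (2 * p) * q)) =
        q / p * ((X * Z - Y) * X' - (X ^ 2 - 1) * Z') := by
      rw [← hpp]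
      field_simp
      push_cast
      linear_combination 2 * (Y * X') * hpp
    refine div_nonpos_of_nonpos_of_nonneg ?_ (by positivity)
    calc _ = q / p * ((X * Z - Y) * X' - (X ^ 2 - 1) * Z') := this
      _ ≤ 0 := mul_nonpos_of_nonneg_of_nonpos (by positivity) hN
  refine antitoneOn_of_deriv_nonpos (convex_Ioi 0) ?_ ?_ ?_
  · intro y hy
    obtain ⟨d, -, h⟩ := hder y hy
    exact h.continuousAt.continuousWithinAt
  · intro y hy
    obtain ⟨d, -, h⟩ := hder y (by simpa using hy)
    exact h.differentiableAt.differentiableWithinAt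
  · intro y hy
    obtain ⟨d, hd, h⟩ := hder y (by simpa using hy)
    rwa [h.deriv]

lemma cosAngle_le_cosAngle {a b c x y z y' z' : ℝ} (ha : a ∈ Icc 0 1) (hb : 0 ≤ b)
    (hc : c ∈ Icc 0 1) (hx : 0 < x) (hy : 0 < y) (hz : 0 < z) (hyy : y ≤ y') (hzz : z ≤ z') :
    cosAngle a b c x y' z' ≤ cosAngle a b c x y z := by
  have hy' : 0 < y' := hy.trans_le hyy
  have hz' : 0 < z' := hz.trans_le hzz
  calc cosAngle a b c x y' z' ≤ cosAngle a b c x y z' :=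
        cosAngle_antitoneOn ha hb hc.1 hx hz' hy hy' hyy
    _ = cosAngle c b a x z' y := cosAngle_comm ..
    _ ≤ cosAngle c b a x z y := cosAngle_antitoneOn hc hb ha.1 hx hy hz hz' hzz
    _ = cosAngle a b c x y z := cosAngle_comm ..

lemma continuousOn_cosAngle {a b c y z : ℝ} (ha : 0 ≤ a) (hc : 0 ≤ c) (hy : 0 < y) (hz : 0 < z) :
    ContinuousOn (fun x => cosAngle a b c x y z) (Ioi 0) := by
  have h : ∀ a y : ℝ, Continuous fun x => coshLength a x y := fun a y => by
    unfold coshLength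
    fun_prop
  have h1 := h a y
  have h2 := h c z
  unfold cosAngle
  refine ContinuousOn.div (by fun_prop) (by fun_prop) fun x hx => ?_
  have hX := one_lt_coshLength ha hx hy
  have hY := one_lt_coshLength hc hx hz
  exact (mul_pos (sqrt_pos.2 (by nlinarith)) (sqrt_pos.2 (by nlinarith))).ne'

/-! ### Radii and conformal factors -/

lemma radius_le_radius {u v : ℝ} (hv : v < 0) (huv : u ≤ v) : radius u ≤ radius v :=
  mul_le_mul_of_nonneg_left (artanh_le_artanh (by linarith [exp_pos u]) (by simpa using hv)
    (exp_le_exp.2 huv)) two_pos.le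

lemma continuousOn_radius : ContinuousOn radius (Iio 0) := by
  have h : ∀ u ∈ Iio (0 : ℝ), 0 < 1 - exp u := fun u hu => by
    have : exp u < 1 := by simpa using hu
    linarith
  unfold radius artanh
  refine continuousOn_const.mul (ContinuousOn.log (ContinuousOn.sqrt (ContinuousOn.div
    (by fun_prop) (by fun_prop) fun u hu => (h u hu).ne')) fun u hu => ?_)
  have := h u hu
  have := exp_pos u
  exact (sqrt_pos.2 (by positivity)).ne'

lemma le_of_radius_le {u R : ℝ} (hu : u < 0) (h : radius u ≤ R) : u ≤ log (tanh (R / 2)) := by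
  rw [← log_tanh_radius hu]
  have h0 : 0 < tanh (radius u / 2) := by
    have := radius_pos hu
    rw [tanh_eq_sinh_div_cosh]
    exact div_pos (sinh_pos_iff.2 (by positivity)) (cosh_pos _)
  refine log_le_log h0 ?_
  by_contra! hlt
  have h1 : ∀ x : ℝ, tanh x ∈ Ioo (-1 : ℝ) 1 := fun x => tanh_bijOn.mapsTo (mem_univ x)
  have := artanh_lt_artanh (h1 (R / 2)).1 (h1 _).2 hlt
  rw [artanh_tanh, artanh_tanh] at this
  linarith

/-! ### Faces at a vertex and their angles -/

lemma innerAngle_eq {Φ : Sym2 V → ℝ} {r : V → ℝ} {i j k : V} (hr : ∀ v, 0 < r v)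
    (hij : 0 ≤ cos (Φ s(i, j))) (hjk : 0 ≤ cos (Φ s(j, k))) (hik : 0 ≤ cos (Φ s(i, k))) :
    innerAngle Φ r i s(j, k) =
      arccos (cosAngle (cos (Φ s(i, j))) (cos (Φ s(j, k))) (cos (Φ s(i, k))) (r i) (r j) (r k)) := by
  have h1 := (one_lt_coshLength hij (hr i) (hr j)).le
  have h2 := (one_lt_coshLength hjk (hr j) (hr k)).le
  have h3 := (one_lt_coshLength hik (hr i) (hr k)).le
  simp only [innerAngle, Sym2.lift_mk, hyperbolicAngle, edgeLength, cosAngle]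
  unfold coshLength at *
  rw [cosh_arcosh h1, cosh_arcosh h2, cosh_arcosh h3, sinh_arcosh h1, sinh_arcosh h3]

lemma exists_of_mem_oppositeEdges {T : AbstractSimplicialComplex V} {i : V} {e : Sym2 V}
    (he : e ∈ oppositeEdges T i) :
    ∃ j k, e = s(j, k) ∧ (skeleton T).Adj i j ∧ (skeleton T).Adj j k ∧ (skeleton T).Adj i k := by
  classical
  obtain ⟨j, k, rfl, f, hf, hcard, hfe⟩ := he
  have hf' : f = {i, j, k} := by
    apply Finset.coe_injective
    simpa using hfe
  obtain ⟨hij, hik, hjk⟩ : i ≠ j ∧ i ≠ k ∧ j ≠ k := by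
    -- A face has three elements, so no two of `i`, `j`, `k` coincide.
    have h2 : ∀ x y : V, f ≠ {x, y} := fun x y h => by
      have := Finset.card_le_two (a := x) (b := y)
      rw [← h] at this
      omega
    refine ⟨?_, ?_, ?_⟩ <;> rintro rfl
    · exact h2 i k (by simpa using hf')
    · exact h2 i j (by rw [hf']; ext; simp; tauto)
    · exact h2 i j (by simpa using hf')
  have hadj : ∀ x y : V, x ≠ y → x ∈ f → y ∈ f → (skeleton T).Adj x y := fun x y hxy hx hy =>
    ⟨hxy, {x, y}, (T.isRelLowerSet_faces hf).2 (by simp [Finset.insert_subset_iff, hx, hy])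
      ⟨x, by simp⟩, by simp⟩
  exact ⟨j, k, rfl, hadj _ _ hij (by simp [hf']) (by simp [hf']),
    hadj _ _ hjk (by simp [hf']) (by simp [hf']), hadj _ _ hik (by simp [hf']) (by simp [hf'])⟩

/-! ### Monotonicity, continuity and bounds for the curvature -/

section Curvature

variable {T : AbstractSimplicialComplex V} {Φ : Sym2 V → ℝ}

lemma cos_mem_Icc_of_adj (hΦ : ∀ e ∈ (skeleton T).edgeSet, Φ e ∈ Icc 0 (π / 2)) {i j : V}
    (h : (skeleton T).Adj i j) : cos (Φ s(i, j)) ∈ Icc 0 1 := by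
  have := hΦ s(i, j) h
  exact ⟨cos_nonneg_of_mem_Icc ⟨by linarith [this.1, pi_pos], this.2⟩, cos_le_one _⟩

/-- The inner angle at `i` as an explicit function of the three conformal factors. -/
lemma exists_innerAngle_eq (hΦ : ∀ e ∈ (skeleton T).edgeSet, Φ e ∈ Icc 0 (π / 2)) {i : V}
    {e : Sym2 V} (he : e ∈ oppositeEdges T i) :
    ∃ j ≠ i, ∃ k ≠ i, ∃ a ∈ Icc (0 : ℝ) 1, ∃ b ∈ Icc (0 : ℝ) 1, ∃ c ∈ Icc (0 : ℝ) 1,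
      ∀ u : V → ℝ, (∀ v, u v < 0) → innerAngle Φ (fun v => radius (u v)) i e =
        arccos (cosAngle a b c (radius (u i)) (radius (u j)) (radius (u k))) := by
  obtain ⟨j, k, rfl, hij, hjk, hik⟩ := exists_of_mem_oppositeEdges he
  have ha := cos_mem_Icc_of_adj hΦ hij
  have hb := cos_mem_Icc_of_adj hΦ hjk
  have hc := cos_mem_Icc_of_adj hΦ hik
  exact ⟨j, hij.ne', k, hik.ne', _, ha, _, hb, _, hc, fun u hu =>
    innerAngle_eq (fun v => radius_pos (hu v)) ha.1 hb.1 hc.1⟩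

lemma curvature_eq (hT : LocallyFinite T) (u : V → ℝ) (i : V) :
    curvature T Φ u i = 2 * π -
      ∑ e ∈ (oppositeEdges_finite hT i).toFinset, innerAngle Φ (fun v => radius (u v)) i e := by
  rw [curvature, finsum_mem_eq_finite_toFinset_sum _ (oppositeEdges_finite hT i)]

/-- With the radius at `i` fixed and the others enlarged, every angle at `i` grows. -/
lemma curvature_le_curvature (hT : LocallyFinite T)
    (hΦ : ∀ e ∈ (skeleton T).edgeSet, Φ e ∈ Icc 0 (π / 2)) {u v : V → ℝ} {i : V}
    (hv : ∀ j, v j < 0) (huv : u ≤ v) (hi : u i = v i) :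
    curvature T Φ v i ≤ curvature T Φ u i := by
  rw [curvature_eq hT, curvature_eq hT]
  refine sub_le_sub_left (Finset.sum_le_sum fun e he => ?_) _
  have hu : ∀ j, u j < 0 := fun j => (huv j).trans_lt (hv j)
  obtain ⟨j, -, k, -, a, ha, b, hb, c, hc, h⟩ := exists_innerAngle_eq hΦ (by simpa using he)
  rw [h u hu, h v hv, hi]
  exact antitone_arccos (cosAngle_le_cosAngle ha hb.1 hc (radius_pos (hv i)) (radius_pos (hu j))
    (radius_pos (hu k)) (radius_le_radius (hv j) (huv j)) (radius_le_radius (hv k) (huv k)))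

/-- The other two vertices of a face at `i` differ from `i`, so only one radius moves in each angle.
-/
lemma continuousOn_curvature_update [DecidableEq V] (hT : LocallyFinite T)
    (hΦ : ∀ e ∈ (skeleton T).edgeSet, Φ e ∈ Icc 0 (π / 2)) {u : V → ℝ} (hu : ∀ j, u j < 0)
    (i : V) : ContinuousOn (fun t => curvature T Φ (Function.update u i t) i) (Iio 0) := by
  simp only [curvature_eq hT]
  refine continuousOn_const.sub (continuousOn_finsetSum _ fun e he => ?_)
  obtain ⟨j, hj, k, hk, a, ha, b, hb, c, hc, h⟩ := exists_innerAngle_eq hΦ (by simpa using he)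
  have hcont : ContinuousOn
      (fun t => arccos (cosAngle a b c (radius t) (radius (u j)) (radius (u k)))) (Iio 0) :=
    continuous_arccos.comp_continuousOn
      ((continuousOn_cosAngle ha.1 hc.1 (radius_pos (hu j)) (radius_pos (hu k))).comp
        continuousOn_radius fun t ht => radius_pos ht)
  refine hcont.congr fun t ht => ?_
  have hneg : ∀ v, Function.update u i t v < 0 := fun v => by
    rcases eq_or_ne v i with rfl | hv
    · simpa using ht
    · simpa [hv] using hu v
  simp only [h _ hneg, Function.update_self, Function.update_of_ne hj, Function.update_of_ne hk]

/-- A bound below `2π` on the curvature at a vertex bounds its conformal factor away from `0`. -/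
lemma exists_upper_bound_of_curvature_le (hT : LocallyFinite T)
    (hΦ : ∀ e ∈ (skeleton T).edgeSet, Φ e ∈ Icc 0 (π / 2)) (i : V) {κ : ℝ} (hκ : κ < 2 * π) :
    ∃ b < 0, ∀ u : V → ℝ, (∀ j, u j < 0) → curvature T Φ u i ≤ κ → u i ≤ b := by
  set s := (oppositeEdges_finite hT i).toFinset with hs
  have hlim : Tendsto (fun S : ℝ => (s.card : ℝ) * arccos (1 - 2 / S ^ 2)) atTop (𝓝 0) := by
    have h1 : Tendsto (fun S : ℝ => 1 - 2 / S ^ 2) atTop (𝓝 (1 - 0)) :=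
      tendsto_const_nhds.sub (tendsto_const_nhds.div_atTop (tendsto_pow_atTop two_ne_zero))
    have h2 := ((continuous_arccos.tendsto _).comp h1).const_mul (s.card : ℝ)
    simpa using h2
  obtain ⟨S₀, hS₀⟩ := eventually_atTop.1 (hlim.eventually (gt_mem_nhds (sub_pos.2 hκ)))
  -- The `1` forces `R > 0`, so that `log (tanh (R / 2))` is a genuine negative bound.
  obtain ⟨R, hR⟩ := sinh_surjective (max S₀ 1)
  have hR0 : 0 < R := sinh_pos_iff.1 (by rw [hR]; positivity)
  have htanh : tanh (R / 2) ∈ Ioo (0 : ℝ) 1 := by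
    refine ⟨?_, (tanh_bijOn.mapsTo (mem_univ (R / 2))).2⟩
    rw [tanh_eq_sinh_div_cosh]
    exact div_pos (sinh_pos_iff.2 (by positivity)) (cosh_pos _)
  refine ⟨log (tanh (R / 2)), log_neg htanh.1 htanh.2, fun u hu hle => ?_⟩
  refine le_of_radius_le (hu i) ?_
  by_contra! hlt
  have hbig : S₀ ≤ sinh (radius (u i)) :=
    (le_max_left S₀ 1).trans (hR ▸ sinh_le_sinh.2 hlt.le)
  have hsum : ∑ e ∈ s, innerAngle Φ (fun v => radius (u v)) i e ≤
      s.card * arccos (1 - 2 / sinh (radius (u i)) ^ 2) := by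
    rw [← nsmul_eq_mul]
    refine Finset.sum_le_card_nsmul _ _ _ fun e he => ?_
    obtain ⟨j, -, k, -, a, ha, b, hb, c, hc, h⟩ :=
      exists_innerAngle_eq hΦ (show e ∈ oppositeEdges T i by simpa [hs] using he)
    rw [h u hu]
    exact antitone_arccos (one_sub_le_cosAngle ha.1 hb.2 hc.1 (radius_pos (hu i))
      (radius_pos (hu j)) (radius_pos (hu k)))
  have := hS₀ _ hbig
  rw [curvature_eq hT] at hle
  linarith

end Curvature

/-! ### Solutions as suprema of subsolutions -/

/-- **Perron's method.** If `F u i` does not increase with the values of `u` away from `i` and is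
continuous in `u i`, then the supremum of the negative functions `u` with `F u ≤ κ` solves
`F u = κ`, provided that there is such a function and that these are bounded away from `0` at each
point. -/
lemma exists_eq_of_subsolution {ι : Type*} [DecidableEq ι] {F : (ι → ℝ) → ι → ℝ} {κ u₀ : ι → ℝ}
    (hmono : ∀ (u v : ι → ℝ) (i : ι), (∀ j, v j < 0) → u ≤ v → u i = v i → F v i ≤ F u i)
    (hcont : ∀ (u : ι → ℝ) (i : ι), (∀ j, u j < 0) →
      ContinuousOn (fun t => F (Function.update u i t) i) (Iio 0))
    (hbound : ∀ i, ∃ b < 0, ∀ u : ι → ℝ, (∀ j, u j < 0) → F u i ≤ κ i → u i ≤ b)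
    (hu₀ : ∀ i, u₀ i < 0) (hF : ∀ i, F u₀ i ≤ κ i) :
    ∃ u : ι → ℝ, (∀ i, u i < 0) ∧ ∀ i, F u i = κ i := by
  choose b hb hub using hbound
  let S : Set (ι → ℝ) := {u | (∀ i, u i < 0) ∧ ∀ i, F u i ≤ κ i}
  have hlub : ∀ i, IsLUB ((fun u : ι → ℝ => u i) '' S) (sSup ((fun u : ι → ℝ => u i) '' S)) :=
    fun i => isLUB_csSup ⟨_, u₀, ⟨hu₀, hF⟩, rfl⟩
      ⟨b i, by rintro _ ⟨u, hu, rfl⟩; exact hub i u hu.1 (hu.2 i)⟩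
  let w : ι → ℝ := fun i => sSup ((fun u : ι → ℝ => u i) '' S)
  have hSw : ∀ u ∈ S, u ≤ w := fun u hu i => (hlub i).1 ⟨u, hu, rfl⟩
  have hw : ∀ i, w i < 0 := fun i => ((hlub i).2 (by
    rintro _ ⟨u, hu, rfl⟩; exact hub i u hu.1 (hu.2 i))).trans_lt (hb i)
  have hneg : ∀ i t, t < 0 → ∀ j, Function.update w i t j < 0 := fun i t ht j => by
    rcases eq_or_ne j i with rfl | hj
    · simpa using ht
    · simpa [hj] using hw j
  have hcontAt : ∀ i, ContinuousAt (fun t => F (Function.update w i t) i) (w i) := fun i =>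
    (hcont w i hw).continuousAt (Iio_mem_nhds (hw i))
  have hle : ∀ i, F w i ≤ κ i := by
    intro i
    have hmem := (hlub i).mem_closure ⟨_, u₀, ⟨hu₀, hF⟩, rfl⟩
    -- Replacing the value of `w` at `i` by `u i` gives a function above `u` that agrees with it at
    -- `i`; continuity then passes to the supremum.
    have hsub : MapsTo (fun t => F (Function.update w i t) i) ((fun u : ι → ℝ => u i) '' S)
        (Iic (κ i)) := by
      rintro _ ⟨u, hu, rfl⟩
      refine (hmono u _ i (hneg i _ (hu.1 i)) ?_ (by simp)).trans (hu.2 i)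
      exact le_update_iff.2 ⟨le_rfl, fun j _ => hSw u hu j⟩
    have := (hcontAt i).continuousWithinAt.mem_closure hmem hsub
    simpa using this
  refine ⟨w, hw, fun i => (hle i).antisymm ?_⟩
  by_contra! hlt
  have hlt' : F (Function.update w i (w i)) i < κ i := by simpa using hlt
  have hev : ∀ᶠ t in 𝓝 (w i), F (Function.update w i t) i < κ i ∧ t < 0 :=
    ((hcontAt i).eventually (gt_mem_nhds hlt')).and (gt_mem_nhds (hw i))
  -- Strict inequality at `i` leaves room to raise `w i` a little. Elsewhere this can only lower
  -- `F`, so the result is a subsolution exceeding the supremum.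
  obtain ⟨t, ⟨ht, ht0⟩, htw⟩ :=
    ((hev.filter_mono nhdsWithin_le_nhds).and (self_mem_nhdsWithin (s := Ioi (w i)))).exists
  have hmem : Function.update w i t ∈ S := by
    refine ⟨hneg i t ht0, fun j => ?_⟩
    rcases eq_or_ne j i with rfl | hj
    · exact ht.le
    · refine (hmono w _ j (hneg i t ht0) ?_ (by simp [hj])).trans (hle j)
      exact le_update_iff.2 ⟨(mem_Ioi.1 htw).le, fun _ _ => le_rfl⟩
  have := hSw _ hmem i
  rw [Function.update_self] at this
  exact absurd (mem_Ioi.1 htw) this.not_gt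

end CirclePacking

end

theorem theorem4p3 {V : Type*} (T : AbstractSimplicialComplex V)
    (hT : CirclePacking.IsInfiniteDiskTriangulation T)
    (Φ : Sym2 V → ℝ)
    (hΦ : ∀ e ∈ (CirclePacking.skeleton T).edgeSet, Φ e ∈ Set.Icc 0 (Real.pi / 2))
    (u₀ : V → ℝ) (hu₀ : ∀ i, u₀ i < 0)
    (K' : V → ℝ)
    (hK' : ∀ i, CirclePacking.curvature T Φ u₀ i ≤ K' i ∧ K' i < 2 * Real.pi) :
    ∃ u : V → ℝ, (∀ i, u i < 0) ∧ ∀ i, CirclePacking.curvature T Φ u i = K' i := by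
  classical
  exact CirclePacking.exists_eq_of_subsolution
    (fun _ _ _ => CirclePacking.curvature_le_curvature hT.locallyFinite hΦ)
    (fun _ i hu => CirclePacking.continuousOn_curvature_update hT.locallyFinite hΦ hu i)
    (fun i => CirclePacking.exists_upper_bound_of_curvature_le hT.locallyFinite hΦ i (hK' i).2)
    hu₀ fun i => (hK' i).1
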